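/- Let $p=p(n)\in(0,1)$ satisfy $p\gg\frac{\log n}{n}$ and $1-p\gg\frac{\log n}{n}$ as $n\to\infty$ (the latter holds in particular whenever $p\to 0$, or whenever $p$ is bounded away from $1$). For all integers $n,s\ge 0$ let $\mathcal P_s=\mathcal P_{n,s}$ be a graph property (a class of graphs closed under isomorphism), which may depend on $n$. Assume that, uniformly over all integers $s\in[0.5np,\,2np]$, the binomial random graph $G_s\sim G(s,p(n))$ satisfies $$\Pr\left(G_s\in\mathcal P_{n,s}\right)=1-o(1)\qquad\text{as } n\to\infty,$$ that is, for every $\varepsilon>0$ there is $n_0$ such that $\Pr(G_s\in\mathcal P_{n,s})\ge 1-\varepsilon$ for all $n\ge n_0$ and all integers $s\in[0.5np,2np]$. Then, with probability tending to $1$ as $n\to\infty$, the random graph $H\sim G(n,p)$ has a unique vertex $u$ of minimum degree, and the subgraph $H[N_H(u)]$ of $H$ induced by the neighbourhood of $u$ belongs to $\mathcal P_{n,d_H(u)}$, where $d_H(u)$ is the degree of $u$. -/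

import Mathlib

open Filter Topology Asymptotics

/-- A graph property: a class of graphs that is closed under isomorphism. -/
structure GraphProperty where
  /-- `P.Holds G` says that the graph `G` has the property `P`. -/
  Holds : ∀ {V : Type}, SimpleGraph V → Prop
  iso_invariant : ∀ {V W : Type} {G : SimpleGraph V} {H : SimpleGraph W},
    Nonempty (G ≃g H) → (Holds G ↔ Holds H)

open scoped Classical in
/-- `u` is the unique vertex of minimum degree of the finite graph `H`: every other vertex has
strictly larger degree. -/
def IsUniqueMinDegreeVertex {V : Type} [Fintype V] (H : SimpleGraph V) (u : V) : Prop :=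
  ∀ v : V, v ≠ u → H.degree u < H.degree v

open scoped Classical in
/-- For a family `P 0, P 1, …` of graph properties: the finite graph `H` has a unique vertex `u` of
minimum degree, and the subgraph `H[N(u)]` induced on the neighbourhood of `u` has the property
`P d` with `d` the degree of `u`. -/
def MinDegreeNeighbourhoodHas {V : Type} [Fintype V] (P : ℕ → GraphProperty)
    (H : SimpleGraph V) : Prop :=
  ∃ u : V, IsUniqueMinDegreeVertex H u ∧
    (P (H.degree u)).Holds (H.induce (H.neighborSet u))

/-!
The proof avoids analysing how the choice of the vertex of minimum degree depends on the edges
inside its neighbourhood. Write `n` for the number of vertices and `b s` for the probability that a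
given vertex has degree `s`, and choose a threshold `t` below the mean degree such that the expected
number `n * ∑ s ≤ t, b s` of vertices of degree at most `t` is a large constant `K`
(`exists_threshold`).

* *Existence.* The events that two given vertices have degrees `s` and `s'` are almost independent:
  the probability of their intersection is `b s * b s'` up to a factor
  `1 + (s - N * p) * (s' - N * p) / (N ^ 2 * p * (1 - p))` with `N = n - 1`
  (`binomialRandom_degree_eq_and_degree_eq`). So the second moment method gives a vertex of degree
  at most `t` with probability at least `1 - O(1 / K)`
  (`binomialRandom_forall_degree_notMem_le`).
* *Uniqueness.* By the same formula, two vertices share a degree `s ≤ t` with probability at most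
  about `K * max_{s ≤ t} n * b s` (`binomialRandom_exists_degree_eq_le`). This is small, because
  slightly below the mean consecutive values of `b` are nearly equal, so that `n * b s` is a small
  fraction of `K` (`mul_binomialMass_le_sum`).
* *The induced graph.* Given that `v` has degree `s`, the graph induced on its neighbourhood is a
  binomial random graph on `s` vertices (`binomialRandom_degree_eq_and_not_holds`). A union bound
  over *all* vertices of degree at most `t`, of which only about `K` are expected, therefore costs
  `K * o(1)` (`binomialRandom_exists_not_holds_le`).

Degrees far below the mean, where the correlation factor is not under control and `s` may leave the
range of the hypothesis, do not occur with high probability. This is the only place where `n * p` and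
`n * (1 - p)` have to exceed every multiple of `log n`: there the ratio of consecutive
values of `b` is bounded away from `1`, so `b` decays geometrically over a range of length
proportional to `n * min p (1 - p)` (`mul_sum_range_binomialMass_le`).
-/

open MeasureTheory Finset

/-! ### Expectations over random subsets of a finite set -/

/-- The expectation of `f T`, where `T` is the random subset of the finite set `U` that contains
each element of `U` independently with probability `p`, written as a weighted sum. -/
noncomputable def bernoulliSum {α : Type*} (U : Finset α) (p : ℝ) (f : Finset α → ℝ) : ℝ :=
  ∑ T ∈ U.powerset, p ^ #T * (1 - p) ^ (#U - #T) * f T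

section BernoulliSum

variable {α β : Type*} {U A B : Finset α} {p : ℝ} {f g : Finset α → ℝ}

lemma bernoulliSum_congr (h : ∀ T ⊆ U, f T = g T) : bernoulliSum U p f = bernoulliSum U p g :=
  sum_congr rfl fun T hT ↦ by rw [h T (mem_powerset.1 hT)]

lemma bernoulliSum_const_mul (c : ℝ) :
    bernoulliSum U p (fun T ↦ c * f T) = c * bernoulliSum U p f := by
  rw [bernoulliSum, bernoulliSum, mul_sum]
  exact sum_congr rfl fun _ _ ↦ by ring

lemma bernoulliSum_one : bernoulliSum U p (fun _ ↦ 1) = 1 := by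
  simp [bernoulliSum, sum_pow_mul_eq_add_pow]

lemma bernoulliSum_const (c : ℝ) : bernoulliSum U p (fun _ ↦ c) = c := by
  simpa [bernoulliSum_one] using bernoulliSum_const_mul (U := U) (p := p) (f := fun _ ↦ 1) c

lemma bernoulliSum_card_eq (k : ℕ) :
    bernoulliSum U p (fun T ↦ if #T = k then 1 else 0) =
      (#U).choose k * p ^ k * (1 - p) ^ (#U - k) := by
  simp only [bernoulliSum, mul_ite, mul_one, mul_zero]
  rw [← sum_filter, ← powersetCard_eq_filter,
    sum_congr rfl fun T hT ↦ by rw [(mem_powersetCard.1 hT).2], sum_const, card_powersetCard,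
    nsmul_eq_mul, mul_assoc]

lemma bernoulliSum_eq_single [DecidableEq α] {S : Finset α} (hS : S ⊆ U) :
    bernoulliSum U p (fun T ↦ if T = S then 1 else 0) = p ^ #S * (1 - p) ^ (#U - #S) := by
  simp [bernoulliSum, hS]

lemma bernoulliSum_map (e : β ↪ α) (U : Finset β) :
    bernoulliSum (U.map e) p f = bernoulliSum U p (fun T ↦ f (T.map e)) := by
  rw [bernoulliSum, bernoulliSum]
  refine (sum_nbij (fun T ↦ T.map e) ?_ ?_ ?_ ?_).symm
  · intro T hT
    simpa using hT
  · intro S _ T _ h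
    exact map_injective e h
  · intro T hT
    obtain ⟨S, hS, rfl⟩ := subset_map_iff.1 (mem_powerset.1 hT)
    exact ⟨S, by simpa using hS, rfl⟩
  · simp

lemma bernoulliSum_union [DecidableEq α] (h : Disjoint A B) :
    bernoulliSum (A ∪ B) p f =
      bernoulliSum A p (fun S ↦ bernoulliSum B p (fun T ↦ f (S ∪ T))) := by
  simp only [bernoulliSum, mul_sum]
  rw [← sum_product' (f := fun S T ↦ p ^ #S * (1 - p) ^ (#A - #S) *
    (p ^ #T * (1 - p) ^ (#B - #T) * f (S ∪ T)))]
  refine sum_nbij' (fun T ↦ (T ∩ A, T ∩ B)) (fun x ↦ x.1 ∪ x.2) ?_ ?_ ?_ ?_ ?_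
  · intro T _
    simp
  · simp only [mem_product, mem_powerset, and_imp, Prod.forall]
    exact fun S T hS hT ↦ union_subset_union hS hT
  · intro T hT
    rw [← inter_union_distrib_left, inter_eq_left.2 (mem_powerset.1 hT)]
  · simp only [mem_product, mem_powerset, and_imp, Prod.forall, Prod.mk.injEq]
    intro S T hS hT
    have h1 := disjoint_iff_inter_eq_empty.1 (h.mono_left hS)
    have h2 := disjoint_iff_inter_eq_empty.1 (h.symm.mono_left hT)
    rw [union_inter_distrib_right, union_inter_distrib_right, h1, h2, inter_eq_left.2 hS,
      inter_eq_left.2 hT]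
    simp
  · intro T hT
    have hT := mem_powerset.1 hT
    have h1 : T ∩ A ∪ T ∩ B = T := by
      rw [← inter_union_distrib_left, inter_eq_left.2 hT]
    have h2 : #T = #(T ∩ A) + #(T ∩ B) := by
      rw [← card_union_of_disjoint (h.mono inter_subset_right inter_subset_right), h1]
    have h3 : #(T ∩ A) ≤ #A := card_le_card inter_subset_right
    have h4 : #(T ∩ B) ≤ #B := card_le_card inter_subset_right
    simp only [h1]
    rw [card_union_of_disjoint h, h2, show #A + #B - (#(T ∩ A) + #(T ∩ B)) =
      (#A - #(T ∩ A)) + (#B - #(T ∩ B)) by omega, pow_add, pow_add]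
    ring

/-- Functions of the parts of a random subset in two disjoint sets are independent. -/
lemma bernoulliSum_mul [DecidableEq α] (h : Disjoint A B) (hA : A ⊆ U) (hB : B ⊆ U)
    (f g : Finset α → ℝ) :
    bernoulliSum U p (fun T ↦ f (T ∩ A) * g (T ∩ B)) =
      bernoulliSum A p f * bernoulliSum B p g := by
  have hU : U = A ∪ (B ∪ (U \ (A ∪ B))) := by
    rw [← union_assoc, union_sdiff_of_subset (union_subset hA hB)]
  have hd : Disjoint (A ∪ B) (U \ (A ∪ B)) := disjoint_sdiff
  rw [disjoint_union_left] at hd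
  rw [hU, bernoulliSum_union (disjoint_union_right.2 ⟨h, hd.1⟩)]
  have key : ∀ S ⊆ A, bernoulliSum (B ∪ (U \ (A ∪ B))) p
      (fun T ↦ f ((S ∪ T) ∩ A) * g ((S ∪ T) ∩ B)) = bernoulliSum B p g * f S := by
    intro S hS
    rw [bernoulliSum_union hd.2, mul_comm, ← bernoulliSum_const_mul]
    refine bernoulliSum_congr fun T hT ↦ ?_
    rw [← bernoulliSum_const (U := U \ (A ∪ B)) (p := p) (f S * g T)]
    refine bernoulliSum_congr fun R hR ↦ ?_
    congr 2
    · grind [Finset.disjoint_left]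
    · grind [Finset.disjoint_left]
  rw [bernoulliSum_congr key, bernoulliSum_const_mul, mul_comm]

/-- A function of the part of a random subset in `A` has the same expectation as the function
of a random subset of `A`. -/
lemma bernoulliSum_inter [DecidableEq α] (hA : A ⊆ U) (f : Finset α → ℝ) :
    bernoulliSum U p (fun T ↦ f (T ∩ A)) = bernoulliSum A p f := by
  simpa [bernoulliSum_one] using
    bernoulliSum_mul (p := p) (disjoint_empty_right A) hA (empty_subset U) f fun _ ↦ 1

/-- Conditioning on whether the element `e` belongs to the random subset. -/
lemma bernoulliSum_insert [DecidableEq α] {e : α} (he : e ∉ A) (f : Finset α → ℝ) :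
    bernoulliSum (insert e A) p f =
      p * bernoulliSum A p (fun T ↦ f (insert e T)) + (1 - p) * bernoulliSum A p f := by
  rw [insert_eq, bernoulliSum_union (disjoint_singleton_left.2 he)]
  conv_lhs => rw [bernoulliSum]
  rw [show ({e} : Finset α).powerset = {∅, {e}} by rfl, sum_pair (by simp)]
  simp [add_comm]

end BernoulliSum

/-! ### The binomial random graph -/

instance {V : Type*} [Finite V] : DiscreteMeasurableSpace (SimpleGraph V) := by
  have : MeasurableSingletonClass (SimpleGraph V) := ⟨fun G ↦ by
    rw [← SimpleGraph.measurableEmbedding_edgeSet.measurableSet_image, Set.image_singleton]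
    exact measurableSet_singleton _⟩
  infer_instance

/-- The edges of the complete graph on `V`. -/
abbrev completeEdges (V : Type*) [Fintype V] [DecidableEq V] : Finset (Sym2 V) :=
  (⊤ : SimpleGraph V).edgeFinset

/-- The edge set of the binomial random graph is a random subset of the edge set of the complete
graph. -/
lemma binomialRandom_real_eq_bernoulliSum {V : Type*} [Fintype V] [DecidableEq V]
    (p : unitInterval) (Q : SimpleGraph V → Prop) [DecidablePred Q] :
    (SimpleGraph.binomialRandom V p).real {G | Q G} =
      bernoulliSum (completeEdges V) (p : ℝ)
        (fun T ↦ if Q (.fromEdgeSet (T : Set (Sym2 V))) then 1 else 0) := by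
  classical
  have hsing : ∀ G : SimpleGraph V, (SimpleGraph.binomialRandom V p).real {G} =
      (p : ℝ) ^ #G.edgeFinset *
        (1 - p : ℝ) ^ (#(⊤ : SimpleGraph V).edgeFinset - #G.edgeFinset) := by
    intro G
    rw [measureReal_def, SimpleGraph.binomialRandom_singleton,
      SimpleGraph.card_edgeFinset_top_eq_card_choose_two, Set.ncard_eq_toFinset_card',
      Nat.card_eq_fintype_card]
    simp [SimpleGraph.edgeFinset]
  rw [show {G | Q G} = ((univ.filter Q : Finset (SimpleGraph V)) : Set _) by simp,
    ← sum_measureReal_singleton]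
  simp only [bernoulliSum, mul_ite, mul_one, mul_zero, hsing, sum_filter]
  refine sum_nbij' (fun G ↦ G.edgeFinset) (fun T ↦ .fromEdgeSet (T : Set (Sym2 V)))
    ?_ ?_ ?_ ?_ ?_
  · intro G _
    exact mem_powerset.2 (SimpleGraph.edgeFinset_mono le_top)
  · simp
  · simp
  · intro T hT
    ext e
    have h : e ∈ T → e ∈ (⊤ : SimpleGraph V).edgeFinset := fun h ↦ mem_powerset.1 hT h
    simpa using h
  · intro G _
    simp

/-! ### Degrees in the binomial random graph -/

/-- The probability that a binomial random variable with parameters `N` and `p` equals `k`. -/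
noncomputable def binomialMass (N : ℕ) (p : ℝ) (k : ℕ) : ℝ :=
  N.choose k * p ^ k * (1 - p) ^ (N - k)

lemma binomialMass_nonneg {p : ℝ} (h0 : 0 ≤ p) (h1 : p ≤ 1) (N k : ℕ) :
    0 ≤ binomialMass N p k := by
  have : 0 ≤ 1 - p := by linarith
  unfold binomialMass
  positivity

lemma binomialMass_mul_succ (N k : ℕ) (p : ℝ) :
    binomialMass N p k * ((N + 1) * p) = binomialMass (N + 1) p (k + 1) * (k + 1) := by
  have h : ((N : ℝ) + 1) * N.choose k = (N + 1).choose (k + 1) * (k + 1) := by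
    exact_mod_cast Nat.add_one_mul_choose_eq N k
  simp only [binomialMass, Nat.add_sub_add_right, pow_succ]
  linear_combination (p ^ k * p * (1 - p) ^ (N - k)) * h

lemma binomialMass_mul_compl (N k : ℕ) (p : ℝ) :
    binomialMass N p k * ((N + 1) * (1 - p)) = binomialMass (N + 1) p k * (N + 1 - k) := by
  rcases le_or_gt k N with hk | hk
  · have h : (N.choose k : ℝ) * (N + 1) = (N + 1).choose k * (N + 1 - k) := by
      have := Nat.choose_mul_succ_eq N k
      rw [← Nat.cast_add_one, ← Nat.cast_sub (by omega)]
      exact_mod_cast this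
    simp only [binomialMass, Nat.succ_sub hk, Nat.succ_eq_add_one, pow_succ]
    linear_combination (p ^ k * (1 - p) ^ (N - k) * (1 - p)) * h
  · rcases Nat.lt_or_ge (N + 1) k with h | h
    · simp [binomialMass, Nat.choose_eq_zero_of_lt hk, Nat.choose_eq_zero_of_lt h]
    · obtain rfl : k = N + 1 := by omega
      simp [binomialMass]

/-- The ratio of consecutive binomial probabilities. -/
lemma binomialMass_succ_mul (N k : ℕ) (p : ℝ) :
    binomialMass N p (k + 1) * ((k + 1) * (1 - p)) = binomialMass N p k * ((N - k) * p) := by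
  rcases le_or_gt k N with hk | hk
  · have h : (N.choose (k + 1) : ℝ) * (k + 1) = N.choose k * (N - k) := by
      rw [← Nat.cast_sub hk]
      exact_mod_cast Nat.choose_succ_right_eq N k
    rcases hk.eq_or_lt with rfl | hk
    · simp [binomialMass]
    · obtain ⟨d, rfl⟩ := Nat.exists_eq_add_of_lt hk
      simp only [binomialMass, show k + d + 1 - k = d + 1 by omega,
        show k + d + 1 - (k + 1) = d by omega, pow_succ]
      linear_combination (p ^ k * p * (1 - p) ^ d * (1 - p)) * h
  · simp [binomialMass, Nat.choose_eq_zero_of_lt hk,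
      Nat.choose_eq_zero_of_lt (hk.trans k.lt_succ_self)]

lemma sum_binomialMass (N : ℕ) (p : ℝ) : ∑ k ∈ range (N + 1), binomialMass N p k = 1 := by
  have := add_pow p (1 - p) N
  rw [add_sub_cancel, one_pow] at this
  rw [this]
  exact sum_congr rfl fun k _ ↦ by unfold binomialMass; ring

section Star

variable {V : Type} [Fintype V] [DecidableEq V]

/-- The edges of the complete graph that contain the vertex `v`. -/
def starEdges (v : V) : Finset (Sym2 V) := completeEdges V |>.filter (v ∈ ·)

lemma starEdges_subset (v : V) : starEdges v ⊆ completeEdges V := filter_subset _ _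

lemma mem_starEdges {v : V} {e : Sym2 V} : e ∈ starEdges v ↔ ¬ e.IsDiag ∧ v ∈ e := by
  simp [starEdges]

lemma card_starEdges (v : V) : #(starEdges v) = Fintype.card V - 1 := by
  rw [← SimpleGraph.complete_graph_degree v, ← SimpleGraph.card_incidenceFinset_eq_degree,
    SimpleGraph.incidenceFinset_eq_filter]
  rfl

lemma degree_fromEdgeSet (T : Finset (Sym2 V)) (v : V)
    [Fintype ((SimpleGraph.fromEdgeSet (T : Set (Sym2 V))).neighborSet v)] :
    (SimpleGraph.fromEdgeSet (T : Set (Sym2 V))).degree v = #(T ∩ starEdges v) := by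
  classical
  rw [← SimpleGraph.card_incidenceFinset_eq_degree, SimpleGraph.incidenceFinset_eq_filter]
  congr 1
  ext e
  simp [mem_starEdges, and_assoc]

lemma starEdges_inter {u v : V} (h : u ≠ v) : starEdges u ∩ starEdges v = {s(u, v)} := by
  ext e
  induction e with
  | _ x y =>
    simp only [mem_inter, mem_starEdges, Sym2.mk_isDiag_iff, Sym2.mem_iff, mem_singleton,
      Sym2.eq_iff]
    grind

end Star

open scoped Classical in
lemma binomialRandom_degree_eq {V : Type} [Fintype V] (p : unitInterval) (v : V) (s : ℕ) :
    (SimpleGraph.binomialRandom V p).real {G | G.degree v = s} =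
      binomialMass (Fintype.card V - 1) p s := by
  rw [binomialRandom_real_eq_bernoulliSum]
  simp only [degree_fromEdgeSet]
  rw [bernoulliSum_inter (starEdges_subset v) (fun T ↦ if #T = s then 1 else 0),
    bernoulliSum_card_eq, card_starEdges, binomialMass]

open scoped Classical in
/-- The joint law of two degrees. The degrees are independent given whether the two vertices are
adjacent, and the two cases recombine so that the correlation is a single product of the
deviations of `s` and `t` from the mean `N * p`. -/
lemma binomialRandom_degree_eq_and_degree_eq {V : Type} [Fintype V] {p : unitInterval}
    (hp : 0 < (p : ℝ)) (hp1 : (p : ℝ) < 1) {u v : V} (huv : u ≠ v) {N : ℕ}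
    (hN : N = Fintype.card V - 1) {s t : ℕ} (hs : 1 ≤ s) (ht : 1 ≤ t) :
    (SimpleGraph.binomialRandom V p).real {G | G.degree u = s ∧ G.degree v = t} =
      binomialMass N p s * binomialMass N p t *
        (1 + (s - N * p) * (t - N * p) / (N ^ 2 * p * (1 - p))) := by
  have hcard : 1 < Fintype.card V := Fintype.one_lt_card_iff.2 ⟨u, v, huv⟩
  obtain ⟨M, rfl⟩ : ∃ M, N = M + 1 := ⟨N - 1, by omega⟩
  obtain ⟨s, rfl⟩ : ∃ s', s = s' + 1 := ⟨s - 1, by omega⟩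
  obtain ⟨t, rfl⟩ : ∃ t', t = t' + 1 := ⟨t - 1, by omega⟩
  set e : Sym2 V := s(u, v) with he_def
  have heu : e ∈ starEdges u := by simp [mem_starEdges, he_def, huv]
  have hev : e ∈ starEdges v := by simp [mem_starEdges, he_def, huv]
  have heU : e ∈ completeEdges V := starEdges_subset u heu
  have hsub : ∀ w : V, (starEdges w).erase e ⊆ (completeEdges V).erase e :=
    fun w ↦ erase_subset_erase _ (starEdges_subset w)
  have hdisj : Disjoint ((starEdges u).erase e) ((starEdges v).erase e) := by
    rw [disjoint_iff_inter_eq_empty, erase_inter, inter_erase, starEdges_inter huv]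
    simp [he_def]
  have hcu : ∀ w, e ∈ starEdges w → #((starEdges w).erase e) = M := by
    intro w hw
    rw [card_erase_of_mem hw, card_starEdges, ← hN, Nat.add_sub_cancel]
  have hin : ∀ w, e ∈ starEdges w → ∀ T ⊆ (completeEdges V).erase e,
      #(insert e T ∩ starEdges w) = #(T ∩ (starEdges w).erase e) + 1 := by
    intro w hw T hT
    have : e ∉ T := fun h ↦ by simpa using hT h
    rw [insert_inter_of_mem hw, card_insert_of_notMem (by simp [this]), inter_erase,
      erase_eq_of_notMem (by simp [this])]
  have hout : ∀ w, ∀ T ⊆ (completeEdges V).erase e,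
      T ∩ starEdges w = T ∩ (starEdges w).erase e := by
    intro w T hT
    have : e ∉ T := fun h ↦ by simpa using hT h
    rw [inter_erase, erase_eq_of_notMem (by simp [this])]
  have hprod : ∀ a b : ℕ, bernoulliSum ((completeEdges V).erase e) (p : ℝ)
      (fun T ↦ (if #(T ∩ (starEdges u).erase e) = a then 1 else 0) *
        (if #(T ∩ (starEdges v).erase e) = b then 1 else 0)) =
      binomialMass M p a * binomialMass M p b := by
    intro a b
    rw [bernoulliSum_mul hdisj (hsub u) (hsub v) (fun T ↦ if #T = a then 1 else 0)
      (fun T ↦ if #T = b then 1 else 0), bernoulliSum_card_eq, bernoulliSum_card_eq,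
      hcu u heu, hcu v hev]
    rfl
  rw [binomialRandom_real_eq_bernoulliSum]
  simp only [degree_fromEdgeSet, ite_and]
  -- If `e` is present, it contributes 1 to both degrees.
  have hadj : bernoulliSum ((completeEdges V).erase e) (p : ℝ) (fun T ↦
      if #(insert e T ∩ starEdges u) = s + 1 then
        if #(insert e T ∩ starEdges v) = t + 1 then 1 else 0 else 0) =
      binomialMass M p s * binomialMass M p t := by
    rw [← hprod]
    refine bernoulliSum_congr fun T hT ↦ ?_
    simp only [hin u heu T hT, hin v hev T hT, add_left_inj]
    split_ifs <;> simp
  have hnadj : bernoulliSum ((completeEdges V).erase e) (p : ℝ) (fun T ↦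
      if #(T ∩ starEdges u) = s + 1 then
        if #(T ∩ starEdges v) = t + 1 then 1 else 0 else 0) =
      binomialMass M p (s + 1) * binomialMass M p (t + 1) := by
    rw [← hprod]
    refine bernoulliSum_congr fun T hT ↦ ?_
    simp only [hout u T hT, hout v T hT]
    split_ifs <;> simp
  rw [← insert_erase heU, bernoulliSum_insert (notMem_erase _ _), hadj, hnadj]
  have hM : (M : ℝ) + 1 ≠ 0 := by positivity
  have hq : 1 - (p : ℝ) ≠ 0 := by linarith
  have h1 : ∀ a, binomialMass M p a = binomialMass (M + 1) p (a + 1) * (a + 1) / ((M + 1) * p) :=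
    fun a ↦ by rw [eq_div_iff (by positivity), binomialMass_mul_succ]
  have h2 : ∀ a, binomialMass M p (a + 1) =
      binomialMass (M + 1) p (a + 1) * (M - a) / ((M + 1) * (1 - p)) := fun a ↦ by
    rw [eq_div_iff (mul_ne_zero hM hq), binomialMass_mul_compl]
    push_cast
    ring
  rw [h1 s, h1 t, h2 s, h2 t]
  push_cast
  field_simp
  ring

/-! ### The graph induced on a neighbourhood -/

open scoped Classical in
/-- The star at `v` and the graph inside a fixed set `S` not containing `v` are independent, so
conditionally on `S` being the neighbourhood of `v` the graph induced on `S` is a binomial random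
graph. -/
lemma binomialRandom_neighborSet_eq_and {V : Type} [Fintype V] (p : unitInterval)
    (P : GraphProperty) {v : V} {S : Finset V} (hv : v ∉ S) :
    (SimpleGraph.binomialRandom V p).real
        {G | G.neighborSet v = (S : Set V) ∧ ¬ P.Holds (G.induce (S : Set V))} =
      (p : ℝ) ^ #S * (1 - p : ℝ) ^ (Fintype.card V - 1 - #S) *
        (SimpleGraph.binomialRandom (Fin #S) p).real {G | ¬ P.Holds G} := by
  let φ : Fin #S ↪ V := S.equivFin.symm.toEmbedding.trans (.subtype _)
  have hφ : ∀ i, φ i ∈ S := fun i ↦ (S.equivFin.symm i).2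
  have hφ' : ∀ x ∈ S, ∃ i, φ i = x := fun x hx ↦ ⟨S.equivFin ⟨x, hx⟩, by simp [φ]⟩
  set B : Finset (Sym2 V) := (completeEdges (Fin #S)).map φ.sym2Map with hB
  have memB : ∀ {x y : V}, x ∈ S → y ∈ S → x ≠ y → s(x, y) ∈ B := by
    intro x y hx hy hxy
    obtain ⟨i, rfl⟩ := hφ' x hx
    obtain ⟨j, rfl⟩ := hφ' y hy
    rw [hB, Finset.mem_map]
    exact ⟨s(i, j), by simpa using fun h ↦ hxy (congrArg φ h), by simp⟩
  have hBU : B ⊆ completeEdges V := by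
    intro e he
    rw [hB, Finset.mem_map] at he
    obtain ⟨e', he', rfl⟩ := he
    induction e' with
    | _ i j => simpa using he'
  have hdisj : Disjoint (starEdges v) B := by
    rw [Finset.disjoint_left]
    intro e he heB
    rw [hB, Finset.mem_map] at heB
    obtain ⟨e', he', rfl⟩ := heB
    induction e' with
    | _ i j =>
      have := (mem_starEdges.1 he).2
      simp only [Function.Embedding.sym2Map_apply, Sym2.map_mk, Sym2.mem_iff] at this
      rcases this with h | h <;> exact hv (h ▸ hφ _)
  -- `F` is the star that has to be present, and `B` is the set of edges inside `S`.
  set F : Finset (Sym2 V) := S.image (s(v, ·)) with hF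
  have hcF : #F = #S := card_image_of_injective _ fun x y h ↦ Sym2.congr_right.1 h
  have hFU : F ⊆ starEdges v := by
    intro e he
    rw [hF, mem_image] at he
    obtain ⟨x, hx, rfl⟩ := he
    simp only [mem_starEdges, Sym2.mk_isDiag_iff, Sym2.mem_iff, true_or, and_true]
    rintro rfl
    exact hv hx
  have hstar : ∀ T : Finset (Sym2 V),
      (SimpleGraph.fromEdgeSet (T : Set (Sym2 V))).neighborSet v = S ↔ T ∩ starEdges v = F := by
    intro T
    constructor
    · intro h
      ext e
      induction e with
      | _ x y =>
        have h1 := Set.ext_iff.1 h x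
        have h2 := Set.ext_iff.1 h y
        simp only [SimpleGraph.mem_neighborSet, SimpleGraph.fromEdgeSet_adj, mem_coe] at h1 h2
        simp only [mem_inter, mem_starEdges, Sym2.mk_isDiag_iff, Sym2.mem_iff, hF, mem_image,
          Sym2.eq_iff]
        have h3 : s(x, y) = s(y, x) := Sym2.eq_swap
        constructor
        · rintro ⟨hT, hxy, rfl | rfl⟩
          · exact ⟨y, h2.1 ⟨hT, hxy⟩, by simp⟩
          · exact ⟨x, h1.1 ⟨h3 ▸ hT, Ne.symm hxy⟩, by simp⟩
        · rintro ⟨z, hz, ⟨rfl, rfl⟩ | ⟨rfl, rfl⟩⟩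
          · exact ⟨(h2.2 hz).1, (h2.2 hz).2, by simp⟩
          · exact ⟨h3 ▸ (h1.2 hz).1, (h1.2 hz).2.symm, by simp⟩
    · intro h
      ext x
      have h1 := Finset.ext_iff.1 h s(v, x)
      simp only [mem_inter, mem_starEdges, Sym2.mk_isDiag_iff, Sym2.mem_iff, hF, mem_image,
        Sym2.eq_iff] at h1
      simp only [SimpleGraph.mem_neighborSet, SimpleGraph.fromEdgeSet_adj, mem_coe]
      constructor
      · rintro ⟨hT, hne⟩
        obtain ⟨z, hz, ⟨_, rfl⟩ | ⟨rfl, rfl⟩⟩ := h1.1 ⟨hT, hne, by simp⟩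
        · exact hz
        · exact absurd rfl hne
      · intro hx
        have := h1.2 ⟨x, hx, by simp⟩
        exact ⟨this.1, this.2.1⟩
  let g : Finset (Sym2 V) → ℝ := fun T ↦
    if ¬ P.Holds ((SimpleGraph.fromEdgeSet (T : Set (Sym2 V))).induce (S : Set V)) then 1 else 0
  have hg : ∀ T : Finset (Sym2 V), g T = g (T ∩ B) := by
    intro T
    have : (SimpleGraph.fromEdgeSet (T : Set (Sym2 V))).induce (S : Set V) =
        (SimpleGraph.fromEdgeSet ((T ∩ B : Finset (Sym2 V)) : Set (Sym2 V))).induce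
          (S : Set V) := by
      ext ⟨x, hx⟩ ⟨y, hy⟩
      simp only [SimpleGraph.comap_adj, Function.Embedding.subtype_apply,
        SimpleGraph.fromEdgeSet_adj, mem_coe, mem_inter]
      exact ⟨fun h ↦ ⟨⟨h.1, memB hx hy h.2⟩, h.2⟩, fun h ↦ ⟨h.1.1, h.2⟩⟩
    simp only [g, this]
  have hgφ : ∀ R : Finset (Sym2 (Fin #S)), g (R.map φ.sym2Map) =
      if ¬ P.Holds (SimpleGraph.fromEdgeSet (R : Set (Sym2 (Fin #S)))) then 1 else 0 := by
    intro R
    have : Nonempty ((SimpleGraph.fromEdgeSet (R : Set (Sym2 (Fin #S)))) ≃g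
        (SimpleGraph.fromEdgeSet ((R.map φ.sym2Map : Finset (Sym2 V)) : Set (Sym2 V))).induce
          (S : Set V)) := by
      refine ⟨⟨S.equivFin.symm, ?_⟩⟩
      intro i j
      have h : s(φ i, φ j) ∈ R.map φ.sym2Map ↔ s(i, j) ∈ R := by
        rw [← Finset.mem_map' φ.sym2Map]
        rfl
      simp only [SimpleGraph.comap_adj, Function.Embedding.subtype_apply,
        SimpleGraph.fromEdgeSet_adj, mem_coe]
      exact and_congr h φ.injective.ne_iff
    simp only [g, P.iso_invariant this]
  rw [binomialRandom_real_eq_bernoulliSum, binomialRandom_real_eq_bernoulliSum,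
    bernoulliSum_congr (g := fun T ↦ (if T ∩ starEdges v = F then 1 else 0) * g (T ∩ B)) ?_,
    bernoulliSum_mul hdisj (starEdges_subset v) hBU (fun T ↦ if T = F then 1 else 0),
    bernoulliSum_eq_single hFU, hcF, card_starEdges, hB, bernoulliSum_map]
  · simp only [hgφ]
  · intro T _
    simp only [← hg, ← hstar T, g]
    split_ifs <;> simp_all

open scoped Classical in
/-- Conditionally on the degree of `v` being `s`, the graph induced on the neighbourhood of `v` is
distributed as the binomial random graph on `s` vertices. -/
lemma binomialRandom_degree_eq_and_not_holds {V : Type} [Fintype V] (p : unitInterval)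
    (P : GraphProperty) (v : V) (s : ℕ) :
    (SimpleGraph.binomialRandom V p).real
        {G | G.degree v = s ∧ ¬ P.Holds (G.induce (G.neighborSet v))} =
      binomialMass (Fintype.card V - 1) p s *
        (SimpleGraph.binomialRandom (Fin s) p).real {G | ¬ P.Holds G} := by
  have hset : {G : SimpleGraph V | G.degree v = s ∧ ¬ P.Holds (G.induce (G.neighborSet v))} =
      ⋃ S ∈ powersetCard s (univ.erase v),
        {G | G.neighborSet v = (S : Set V) ∧ ¬ P.Holds (G.induce (S : Set V))} := by
    ext G
    simp only [Set.mem_ofPred_eq, Set.mem_iUnion, mem_powersetCard]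
    constructor
    · rintro ⟨hd, hP⟩
      refine ⟨G.neighborFinset v, ⟨?_, (G.card_neighborFinset_eq_degree v).trans hd⟩,
        (G.coe_neighborFinset v).symm, by rwa [G.coe_neighborFinset v]⟩
      intro x hx
      have := (G.mem_neighborFinset v x).1 hx
      simpa using this.ne'
    · rintro ⟨S, ⟨_, hS⟩, hN, hP⟩
      refine ⟨?_, by rwa [hN]⟩
      rw [← SimpleGraph.card_neighborFinset_eq_degree, ← hS]
      congr 1
      exact_mod_cast (G.coe_neighborFinset v).trans hN
  rw [hset, measureReal_biUnion_finset]
  · rw [sum_congr rfl fun S hS ↦ by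
      obtain ⟨hSv, hS⟩ := mem_powersetCard.1 hS
      rw [binomialRandom_neighborSet_eq_and p P (fun h ↦ by simpa using hSv h), hS]]
    rw [sum_const, card_powersetCard, card_erase_of_mem (mem_univ v), card_univ, nsmul_eq_mul,
      binomialMass]
    ring
  · intro S _ S' _ hne
    rw [Function.onFun, Set.disjoint_left]
    rintro G ⟨h1, _⟩ ⟨h2, _⟩
    exact hne (by exact_mod_cast h1.symm.trans h2)
  · exact fun _ _ ↦ .of_discrete

/-! ### The second moment method -/

/-- **Second moment method** for the number of events that occur: Chebyshev's inequality bounds the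
probability that none of the events `A i` occurs. -/
lemma measureReal_iInter_compl_mul_sq_le {Ω ι : Type*} [MeasurableSpace Ω] [Fintype ι]
    (μ : Measure Ω) [IsProbabilityMeasure μ] (A : ι → Set Ω) (hA : ∀ i, MeasurableSet (A i)) :
    μ.real (⋂ i, (A i)ᶜ) * (∑ i, μ.real (A i)) ^ 2 ≤
      ∑ i, ∑ j, μ.real (A i ∩ A j) - (∑ i, μ.real (A i)) ^ 2 := by
  set m := ∑ i, μ.real (A i) with hm
  let f : ι → Ω → ℝ := fun i ↦ (A i).indicator 1
  have hf : ∀ i, Integrable (f i) μ := fun i ↦ (integrable_const (1 : ℝ)).indicator (hA i)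
  have hfi : ∀ i, ∫ ω, f i ω ∂μ = μ.real (A i) := fun i ↦ integral_indicator_one (hA i)
  have hff : ∀ i j, (fun ω ↦ f i ω * f j ω) = (A i ∩ A j).indicator 1 := by
    intro i j
    ext ω
    by_cases h1 : ω ∈ A i <;> by_cases h2 : ω ∈ A j <;> simp [f, h1, h2]
  have hff' : ∀ i j, Integrable (fun ω ↦ f i ω * f j ω) μ := fun i j ↦ by
    rw [hff]
    exact (integrable_const (1 : ℝ)).indicator ((hA i).inter (hA j))
  have hffi : ∀ i j, ∫ ω, f i ω * f j ω ∂μ = μ.real (A i ∩ A j) := fun i j ↦ by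
    rw [hff]
    exact integral_indicator_one ((hA i).inter (hA j))
  have hexp : (fun ω ↦ (∑ i, f i ω - m) ^ 2) =
      fun ω ↦ ∑ i, ∑ j, f i ω * f j ω - 2 * m * ∑ i, f i ω + m ^ 2 := by
    ext ω
    rw [← sum_mul_sum]
    ring
  have hi1 : Integrable (fun ω ↦ ∑ i, ∑ j, f i ω * f j ω) μ :=
    integrable_finsetSum _ fun i _ ↦ integrable_finsetSum _ fun j _ ↦ hff' i j
  have hi2 : Integrable (fun ω ↦ 2 * m * ∑ i, f i ω) μ :=
    (integrable_finsetSum _ fun i _ ↦ hf i).const_mul _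
  have hint : ∫ ω, (∑ i, f i ω - m) ^ 2 ∂μ = ∑ i, ∑ j, μ.real (A i ∩ A j) - m ^ 2 := by
    have hi3 : Integrable (fun ω ↦ ∑ i, ∑ j, f i ω * f j ω - 2 * m * ∑ i, f i ω) μ := hi1.sub hi2
    rw [hexp, integral_add hi3 (integrable_const _), integral_sub hi1 hi2,
      integral_const_mul, integral_finsetSum _ fun i _ ↦ hf i,
      integral_finsetSum _ fun i _ ↦ integrable_finsetSum _ fun j _ ↦ hff' i j]
    simp_rw [integral_finsetSum _ fun j _ ↦ hff' _ j, hffi, hfi, ← hm]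
    simp
    ring
  have hmeas : MeasurableSet (⋂ i, (A i)ᶜ) := .iInter fun i ↦ (hA i).compl
  rw [← hint, ← integral_indicator_one hmeas, ← integral_mul_const]
  refine integral_mono ?_ ?_ ?_
  · exact ((integrable_const (1 : ℝ)).indicator hmeas).mul_const _
  · rw [hexp]
    exact (hi1.sub hi2).add (integrable_const _)
  · intro ω
    dsimp only
    by_cases h : ω ∈ ⋂ i, (A i)ᶜ
    · have : ∀ i, f i ω = 0 := fun i ↦ Set.indicator_of_notMem (Set.mem_iInter.1 h i) _
      simp [h, this]
    · simp only [Set.indicator_of_notMem h, zero_mul]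
      positivity

/-! ### The vertex of minimum degree -/

lemma setOf_mem_and_eq_biUnion {Ω β : Type*} (f : Ω → β) (Q : Ω → Prop) (I : Finset β) :
    {ω | f ω ∈ I ∧ Q ω} = ⋃ s ∈ I, {ω | f ω = s ∧ Q ω} := by
  ext ω
  simp

section MinDegree

open scoped Classical

variable {V : Type} [Fintype V] {p : unitInterval}

lemma binomialRandom_degree_mem (v : V) (I : Finset ℕ) :
    (SimpleGraph.binomialRandom V p).real {G | G.degree v ∈ I} =
      ∑ s ∈ I, binomialMass (Fintype.card V - 1) p s := by
  have h := setOf_mem_and_eq_biUnion (fun G : SimpleGraph V ↦ G.degree v) (fun _ ↦ True) I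
  simp only [and_true] at h
  rw [h, measureReal_biUnion_finset]
  · exact sum_congr rfl fun s _ ↦ binomialRandom_degree_eq p v s
  · intro s _ t _ hst
    rw [Function.onFun, Set.disjoint_left]
    exact fun G h1 h2 ↦ hst (h1.symm.trans h2)
  · exact fun _ _ ↦ .of_discrete

variable {N : ℕ} {I : Finset ℕ} {κ : ℝ}

lemma binomialRandom_degree_eq_and_degree_eq_le
    (hp : 0 < (p : ℝ)) (hp1 : (p : ℝ) < 1) {u v : V} (huv : u ≠ v)
    (hN : N = Fintype.card V - 1) {s t : ℕ} (hs : 1 ≤ s) (ht : 1 ≤ t)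
    (hκ : (s - N * p : ℝ) * (t - N * p) / (N ^ 2 * p * (1 - p)) ≤ κ) :
    (SimpleGraph.binomialRandom V p).real {G | G.degree u = s ∧ G.degree v = t} ≤
      (1 + κ) * (binomialMass N p s * binomialMass N p t) := by
  rw [binomialRandom_degree_eq_and_degree_eq hp hp1 huv hN hs ht, mul_comm]
  have h1 := binomialMass_nonneg hp.le hp1.le N s
  have h2 := binomialMass_nonneg hp.le hp1.le N t
  gcongr

lemma binomialRandom_degree_mem_and_degree_mem_le
    (hp : 0 < (p : ℝ)) (hp1 : (p : ℝ) < 1) {u v : V} (huv : u ≠ v)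
    (hN : N = Fintype.card V - 1) (hI : ∀ s ∈ I, 1 ≤ s)
    (hκ : ∀ s ∈ I, ∀ t ∈ I,
      (s - N * p : ℝ) * (t - N * p) / (N ^ 2 * p * (1 - p)) ≤ κ) :
    (SimpleGraph.binomialRandom V p).real {G | G.degree u ∈ I ∧ G.degree v ∈ I} ≤
      (1 + κ) * (∑ s ∈ I, binomialMass N p s) ^ 2 := by
  rw [setOf_mem_and_eq_biUnion]
  refine (measureReal_biUnion_finset_le _ _).trans ?_
  rw [sq, sum_mul_sum, mul_sum]
  refine sum_le_sum fun s hs ↦ ?_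
  rw [show {G : SimpleGraph V | G.degree u = s ∧ G.degree v ∈ I} =
    ⋃ t ∈ I, {G | G.degree u = s ∧ G.degree v = t} by ext G; simp]
  refine (measureReal_biUnion_finset_le _ _).trans ?_
  rw [mul_sum]
  exact sum_le_sum fun t ht ↦ binomialRandom_degree_eq_and_degree_eq_le hp hp1 huv hN
    (hI s hs) (hI t ht) (hκ s hs t ht)

/-- Some vertex has degree in `I` as soon as the expected number of such vertices is large and
the correlation between two degrees in `I` is small. -/
lemma binomialRandom_forall_degree_notMem_le
    (hp : 0 < (p : ℝ)) (hp1 : (p : ℝ) < 1)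
    (hN : N = Fintype.card V - 1) (hI : ∀ s ∈ I, 1 ≤ s) (hκ0 : 0 ≤ κ)
    (hκ : ∀ s ∈ I, ∀ t ∈ I,
      (s - N * p : ℝ) * (t - N * p) / (N ^ 2 * p * (1 - p)) ≤ κ)
    {m : ℝ} (hm : m = Fintype.card V * ∑ s ∈ I, binomialMass N p s) (hm0 : 0 < m) :
    (SimpleGraph.binomialRandom V p).real {G | ∀ v, G.degree v ∉ I} ≤ 1 / m + κ := by
  set A : V → Set (SimpleGraph V) := fun v ↦ {G | G.degree v ∈ I} with hA
  have hAm : ∀ v, (SimpleGraph.binomialRandom V p).real (A v) =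
      ∑ s ∈ I, binomialMass N p s := fun v ↦ by
    rw [hA, hN, ← binomialRandom_degree_mem]
  have hsum : ∑ v, (SimpleGraph.binomialRandom V p).real (A v) = m := by
    simp [hAm, hm]
  have key := measureReal_iInter_compl_mul_sq_le (SimpleGraph.binomialRandom V p) A
    fun _ ↦ .of_discrete
  rw [hsum] at key
  have hpair : ∑ u, ∑ v, (SimpleGraph.binomialRandom V p).real (A u ∩ A v) ≤
      m + (1 + κ) * m ^ 2 := by
    have hle : ∀ u v, (SimpleGraph.binomialRandom V p).real (A u ∩ A v) ≤
        (if u = v then ∑ s ∈ I, binomialMass N p s else 0) +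
          (1 + κ) * (∑ s ∈ I, binomialMass N p s) ^ 2 := by
      intro u v
      split_ifs with h
      · rw [h, Set.inter_self, hAm]
        exact le_add_of_nonneg_right (by positivity)
      · rw [zero_add]
        exact binomialRandom_degree_mem_and_degree_mem_le hp hp1 h hN hI hκ
    refine (sum_le_sum fun u _ ↦ sum_le_sum fun v _ ↦ hle u v).trans_eq ?_
    simp [sum_add_distrib, hm]
    ring
  have hset : {G : SimpleGraph V | ∀ v, G.degree v ∉ I} = ⋂ v, (A v)ᶜ := by
    ext G
    simp [hA]
  rw [hset, show 1 / m + κ = (m + κ * m ^ 2) / m ^ 2 by field_simp, le_div_iff₀ (by positivity)]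
  linarith

/-- Two vertices of the same degree in `I` are unlikely if the expected number of vertices with
degree in `I` is bounded and each single degree in `I` is rare. -/
lemma binomialRandom_exists_degree_eq_le
    (hp : 0 < (p : ℝ)) (hp1 : (p : ℝ) < 1)
    (hN : N = Fintype.card V - 1) (hI : ∀ s ∈ I, 1 ≤ s) (hκ0 : 0 ≤ κ)
    (hκ : ∀ s ∈ I, ∀ t ∈ I,
      (s - N * p : ℝ) * (t - N * p) / (N ^ 2 * p * (1 - p)) ≤ κ)
    {m c : ℝ} (hm : m = Fintype.card V * ∑ s ∈ I, binomialMass N p s)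
    (hc : ∀ s ∈ I, Fintype.card V * binomialMass N p s ≤ c) :
    (SimpleGraph.binomialRandom V p).real
      {G | ∃ u v, u ≠ v ∧ G.degree u ∈ I ∧ G.degree u = G.degree v} ≤ (1 + κ) * (m * c) := by
  have hset : {G : SimpleGraph V | ∃ u v, u ≠ v ∧ G.degree u ∈ I ∧ G.degree u = G.degree v} =
      ⋃ u ∈ (univ : Finset V), ⋃ v ∈ (univ.erase u : Finset V), ⋃ s ∈ I,
        {G | G.degree u = s ∧ G.degree v = s} := by
    ext G
    simp only [Set.mem_ofPred_eq, Set.mem_iUnion, mem_univ, mem_erase]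
    constructor
    · rintro ⟨u, v, huv, hI, h⟩
      exact ⟨u, trivial, v, ⟨huv.symm, trivial⟩, _, hI, rfl, h.symm⟩
    · rintro ⟨u, _, v, ⟨huv, _⟩, s, hs, rfl, h⟩
      exact ⟨u, v, huv.symm, hs, h.symm⟩
  have hb := fun s ↦ binomialMass_nonneg hp.le hp1.le N s
  have hpt : ∀ u v : V, u ≠ v → (SimpleGraph.binomialRandom V p).real
      (⋃ s ∈ I, {G | G.degree u = s ∧ G.degree v = s}) ≤
      (1 + κ) * ∑ s ∈ I, binomialMass N p s * binomialMass N p s := by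
    intro u v huv
    refine (measureReal_biUnion_finset_le _ _).trans ?_
    rw [mul_sum]
    exact sum_le_sum fun s hs ↦ binomialRandom_degree_eq_and_degree_eq_le hp hp1 huv hN
      (hI s hs) (hI s hs) (hκ s hs s hs)
  have hnn : 0 ≤ (1 + κ) * ∑ s ∈ I, binomialMass N p s * binomialMass N p s :=
    mul_nonneg (by positivity) (sum_nonneg fun s _ ↦ mul_self_nonneg _)
  rw [hset]
  calc _ ≤ ∑ u : V, ∑ v ∈ (univ.erase u : Finset V),
        (1 + κ) * ∑ s ∈ I, binomialMass N p s * binomialMass N p s :=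
        (measureReal_biUnion_finset_le _ _).trans <| sum_le_sum fun u _ ↦
          (measureReal_biUnion_finset_le _ _).trans <| sum_le_sum fun v hv ↦
            hpt u v (ne_of_mem_erase hv).symm
    _ ≤ ∑ u : V, ∑ v : V, (1 + κ) * ∑ s ∈ I, binomialMass N p s * binomialMass N p s :=
        sum_le_sum fun u _ ↦ sum_le_sum_of_subset_of_nonneg (erase_subset _ _) fun _ _ _ ↦ hnn
    _ = (1 + κ) * ∑ s ∈ I, (Fintype.card V * binomialMass N p s) *
          (Fintype.card V * binomialMass N p s) := by
        simp only [sum_const, card_univ, nsmul_eq_mul, mul_sum]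
        exact sum_congr rfl fun s _ ↦ by ring
    _ ≤ (1 + κ) * ∑ s ∈ I, (Fintype.card V * binomialMass N p s) * c := by
        gcongr with s hs
        · exact mul_nonneg (by positivity) (hb s)
        · exact hc s hs
    _ = (1 + κ) * (m * c) := by rw [← sum_mul, ← mul_sum, ← hm]

/-- A union bound over all vertices with degree in `I`: it costs only the expected number of
these vertices. -/
lemma binomialRandom_exists_not_holds_le (hp : 0 < (p : ℝ)) (hp1 : (p : ℝ) < 1)
    (hN : N = Fintype.card V - 1) (P : ℕ → GraphProperty)
    {m η : ℝ} (hm : m = Fintype.card V * ∑ s ∈ I, binomialMass N p s)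
    (hη : ∀ s ∈ I, (SimpleGraph.binomialRandom (Fin s) p).real {G | ¬ (P s).Holds G} ≤ η) :
    (SimpleGraph.binomialRandom V p).real
      {G | ∃ v, G.degree v ∈ I ∧ ¬ (P (G.degree v)).Holds (G.induce (G.neighborSet v))} ≤
      m * η := by
  have hset : {G : SimpleGraph V | ∃ v, G.degree v ∈ I ∧
      ¬ (P (G.degree v)).Holds (G.induce (G.neighborSet v))} =
      ⋃ v ∈ (univ : Finset V), ⋃ s ∈ I,
        {G | G.degree v = s ∧ ¬ (P s).Holds (G.induce (G.neighborSet v))} := by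
    ext G
    simp
  rw [hset]
  calc _ ≤ ∑ v : V, ∑ s ∈ I, binomialMass N p s * η := by
        refine (measureReal_biUnion_finset_le _ _).trans <| sum_le_sum fun u _ ↦
          (measureReal_biUnion_finset_le _ _).trans <| sum_le_sum fun s hs ↦ ?_
        rw [binomialRandom_degree_eq_and_not_holds, ← hN]
        exact mul_le_mul_of_nonneg_left (hη s hs) (binomialMass_nonneg hp.le hp1.le N s)
    _ = m * η := by
        rw [hm, ← sum_mul]
        simp
        ring

/-- The finite form of the argument: `I` is an interval of degrees whose lower end is, with
high probability, below all degrees of the graph. -/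
lemma binomialRandom_not_minDegreeNeighbourhoodHas_le
    (hp : 0 < (p : ℝ)) (hp1 : (p : ℝ) < 1)
    (hN : N = Fintype.card V - 1) (P : ℕ → GraphProperty) {a b : ℕ} (ha : 1 ≤ a) (hκ0 : 0 ≤ κ)
    (hκ : ∀ s ∈ Icc a b, ∀ t ∈ Icc a b,
      (s - N * p : ℝ) * (t - N * p) / (N ^ 2 * p * (1 - p)) ≤ κ)
    {m c η : ℝ} (hm : m = Fintype.card V * ∑ s ∈ Icc a b, binomialMass N p s) (hm0 : 0 < m)
    (hc : ∀ s ∈ Icc a b, Fintype.card V * binomialMass N p s ≤ c)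
    (hη : ∀ s ∈ Icc a b,
      (SimpleGraph.binomialRandom (Fin s) p).real {G | ¬ (P s).Holds G} ≤ η) :
    (SimpleGraph.binomialRandom V p).real {G | ¬ MinDegreeNeighbourhoodHas P G} ≤
      Fintype.card V * ∑ s ∈ range a, binomialMass N p s + (1 / m + κ) +
        (1 + κ) * (m * c) + m * η := by
  have hI : ∀ s ∈ Icc a b, 1 ≤ s := fun s hs ↦ ha.trans (mem_Icc.1 hs).1
  have hlow : (SimpleGraph.binomialRandom V p).real {G | ∃ v, G.degree v ∈ range a} ≤
      Fintype.card V * ∑ s ∈ range a, binomialMass N p s := by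
    rw [show {G : SimpleGraph V | ∃ v, G.degree v ∈ range a} =
      ⋃ v ∈ (univ : Finset V), {G | G.degree v ∈ range a} by ext G; simp]
    refine (measureReal_biUnion_finset_le _ _).trans_eq ?_
    simp only [binomialRandom_degree_mem, ← hN]
    simp
  have hsub : {G : SimpleGraph V | ¬ MinDegreeNeighbourhoodHas P G} ⊆
      ((({G | ∃ v, G.degree v ∈ range a} ∪ {G | ∀ v, G.degree v ∉ Icc a b}) ∪
        {G | ∃ u v, u ≠ v ∧ G.degree u ∈ Icc a b ∧ G.degree u = G.degree v}) ∪
        {G | ∃ v, G.degree v ∈ Icc a b ∧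
          ¬ (P (G.degree v)).Holds (G.induce (G.neighborSet v))}) := by
    intro G hG
    by_contra hcon
    simp only [Set.mem_union, Set.mem_ofPred_eq, not_or, not_exists, not_forall, not_and,
      not_not, mem_range, not_lt] at hcon hG
    obtain ⟨⟨⟨h1, v, hv⟩, h3⟩, h4⟩ := hcon
    obtain ⟨u, -, hu⟩ := exists_min_image univ (fun w ↦ G.degree w) ⟨v, mem_univ v⟩
    have huI : G.degree u ∈ Icc a b :=
      mem_Icc.2 ⟨h1 u, (hu v (mem_univ v)).trans (mem_Icc.1 hv).2⟩
    exact hG ⟨u, fun w hw ↦ lt_of_le_of_ne (hu w (mem_univ w)) (h3 u w hw.symm huI), h4 u huI⟩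
  refine (measureReal_mono hsub).trans ?_
  refine (measureReal_union_le _ _).trans (add_le_add ?_
    (binomialRandom_exists_not_holds_le hp hp1 hN P hm hη))
  refine (measureReal_union_le _ _).trans (add_le_add ?_
    (binomialRandom_exists_degree_eq_le hp hp1 hN hI hκ0 hκ hm hc))
  exact (measureReal_union_le _ _).trans (add_le_add hlow
    (binomialRandom_forall_degree_notMem_le hp hp1 hN hI hκ0 hκ hm hm0))

end MinDegree

/-! ### The lower tail of the binomial distribution -/

section BinomialMass

variable {N k : ℕ} {p : ℝ}

lemma binomialMass_le_succ (h0 : 0 < p) (h1 : p < 1) (hk : (k + 1 : ℝ) ≤ (N + 1) * p) :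
    binomialMass N p k ≤ binomialMass N p (k + 1) := by
  have h := binomialMass_succ_mul N k p
  have hb := binomialMass_nonneg h0.le h1.le N k
  have hpos : 0 < (k + 1) * (1 - p) := mul_pos (by positivity) (by linarith)
  refine le_of_mul_le_mul_right ?_ hpos
  rw [h]
  exact mul_le_mul_of_nonneg_left (by linarith) hb

lemma binomialMass_succ_le (h0 : 0 < p) (h1 : p < 1) (hk : (N + 1) * p ≤ (k + 1 : ℝ)) :
    binomialMass N p (k + 1) ≤ binomialMass N p k := by
  have h := binomialMass_succ_mul N k p
  have hb := binomialMass_nonneg h0.le h1.le N k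
  have hpos : 0 < (k + 1) * (1 - p) := mul_pos (by positivity) (by linarith)
  refine le_of_mul_le_mul_right ?_ hpos
  rw [h]
  exact mul_le_mul_of_nonneg_left (by linarith) hb

lemma binomialMass_le_of_le (h0 : 0 < p) (h1 : p < 1) {t : ℕ} (ht : (t : ℝ) ≤ (N + 1) * p)
    (hkt : k ≤ t) : binomialMass N p k ≤ binomialMass N p t := by
  induction t, hkt using Nat.le_induction with
  | base => exact le_rfl
  | succ t _ ih =>
    push_cast at ht
    exact (ih (by linarith)).trans (binomialMass_le_succ h0 h1 ht)

/-- The integer part of `(N + 1) * p` is a mode of the binomial distribution. -/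
lemma binomialMass_le_floor (h0 : 0 < p) (h1 : p < 1) (k : ℕ) :
    binomialMass N p k ≤ binomialMass N p ⌊(N + 1) * p⌋₊ := by
  have hnn : 0 ≤ (N + 1) * p := by positivity
  rcases le_total k ⌊(N + 1) * p⌋₊ with h | h
  · exact binomialMass_le_of_le h0 h1 (Nat.floor_le hnn) h
  · induction k, h using Nat.le_induction with
    | base => exact le_rfl
    | succ k hk ih =>
      refine (binomialMass_succ_le h0 h1 ?_).trans ih
      have : (⌊(N + 1) * p⌋₊ : ℝ) ≤ k := by exact_mod_cast hk
      linarith [Nat.lt_floor_add_one ((N + 1) * p)]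

lemma one_le_mul_binomialMass_floor (h0 : 0 < p) (h1 : p < 1) :
    1 ≤ (N + 1) * binomialMass N p ⌊(N + 1) * p⌋₊ := by
  refine (sum_binomialMass N p).ge.trans ?_
  refine (sum_le_sum fun k _ ↦ binomialMass_le_floor h0 h1 k).trans_eq ?_
  simp

lemma binomialMass_le_one (h0 : 0 < p) (h1 : p < 1) (k : ℕ) : binomialMass N p k ≤ 1 := by
  rcases le_or_gt k N with h | h
  · rw [← sum_binomialMass N p]
    exact single_le_sum (fun i _ ↦ binomialMass_nonneg h0.le h1.le N i)
      (mem_range.2 (Nat.lt_succ_of_le h))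
  · simp [binomialMass, Nat.choose_eq_zero_of_lt h]

variable {m : ℝ}

/-- Consecutive probabilities are almost equal slightly below the mean. -/
lemma mul_binomialMass_succ_le (h0 : 0 < p) (h1 : p < 1) (hmp : m ≤ p) (hmq : m ≤ 1 - p)
    {δ : ℝ} (hδ : 0 ≤ δ) (hk : (N + 1) * p - δ * ((N + 1) * m) ≤ k + 1) :
    (1 - 2 * δ) * binomialMass N p (k + 1) ≤ binomialMass N p k := by
  have hq : 0 < 1 - p := by linarith
  have h := binomialMass_succ_mul N k p
  have hb := binomialMass_nonneg h0.le h1.le N k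
  have hb' := binomialMass_nonneg h0.le h1.le N (k + 1)
  have hN : (0 : ℝ) < N + 1 := by positivity
  have e1 : (N - k : ℝ) ≤ (1 + δ) * ((N + 1) * (1 - p)) := by
    have : δ * ((N + 1) * m) ≤ δ * ((N + 1) * (1 - p)) := by gcongr
    linarith
  have e2 : (1 - δ) * ((N + 1) * p) ≤ k + 1 := by
    have : δ * ((N + 1) * m) ≤ δ * ((N + 1) * p) := by gcongr
    linarith
  have e3 : (1 - δ) * binomialMass N p (k + 1) ≤ (1 + δ) * binomialMass N p k := by
    refine le_of_mul_le_mul_right ?_ (mul_pos (mul_pos hN h0) hq)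
    calc (1 - δ) * binomialMass N p (k + 1) * ((N + 1) * p * (1 - p))
        = binomialMass N p (k + 1) * (((1 - δ) * ((N + 1) * p)) * (1 - p)) := by ring
      _ ≤ binomialMass N p (k + 1) * ((k + 1) * (1 - p)) := by gcongr
      _ = binomialMass N p k * ((N - k) * p) := h
      _ ≤ binomialMass N p k * (((1 + δ) * ((N + 1) * (1 - p))) * p) := by gcongr
      _ = (1 + δ) * binomialMass N p k * ((N + 1) * p * (1 - p)) := by ring
  refine le_of_mul_le_mul_left ?_ (show 0 < 1 + δ by linarith)
  refine le_trans ?_ e3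
  rw [← mul_assoc]
  exact mul_le_mul_of_nonneg_right (by nlinarith) hb'

lemma pow_mul_binomialMass_le (h0 : 0 < p) (h1 : p < 1) (hmp : m ≤ p) (hmq : m ≤ 1 - p)
    {δ : ℝ} (hδ : 0 ≤ δ) (hδ' : δ ≤ 1 / 2) (hk : (N + 1) * p - δ * ((N + 1) * m) ≤ k) (j : ℕ) :
    (1 - 2 * δ) ^ j * binomialMass N p (k + j) ≤ binomialMass N p k := by
  induction j with
  | zero => simp
  | succ j ih =>
    refine le_trans ?_ ih
    rw [pow_succ, mul_assoc, ← add_assoc]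
    have h2 : 0 ≤ 1 - 2 * δ := by linarith
    refine mul_le_mul_of_nonneg_left ?_ (by positivity)
    exact mul_binomialMass_succ_le h0 h1 hmp hmq hδ (by push_cast; linarith)

/-- A single probability slightly below the mean is small compared to the lower tail, which
contains `M` terms of about the same size. -/
lemma mul_binomialMass_le_sum (h0 : 0 < p) (h1 : p < 1) (hmp : m ≤ p) (hmq : m ≤ 1 - p)
    {M t : ℕ} (hM : 0 < M)
    (ht : (N + 1) * p - 1 / (4 * M) * ((N + 1) * m) + M ≤ t) (hMt : M ≤ t) :
    M / 2 * binomialMass N p t ≤ ∑ s ∈ range t, binomialMass N p s := by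
  have hM1 : (1 : ℝ) ≤ M := by exact_mod_cast hM
  have hδ : (0 : ℝ) ≤ 1 / (4 * M) := by positivity
  have hδ' : 1 / (4 * M) ≤ (1 / 2 : ℝ) := by
    rw [div_le_div_iff₀ (by positivity) (by norm_num)]
    linarith
  have hb := binomialMass_nonneg h0.le h1.le N
  -- Bernoulli's inequality: the ratio of two probabilities at distance at most `M` is at least 1/2.
  have hhalf : ∀ j ≤ M, (1 / 2 : ℝ) ≤ (1 - 2 * (1 / (4 * M))) ^ j := by
    intro j hj
    have h := one_add_mul_le_pow (a := -(2 * (1 / (4 * M) : ℝ))) (by linarith) j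
    rw [← sub_eq_add_neg] at h
    refine le_trans ?_ h
    have : (j : ℝ) * (2 * (1 / (4 * M))) ≤ M * (2 * (1 / (4 * M))) := by gcongr
    have e : (M : ℝ) * (2 * (1 / (4 * M))) = 1 / 2 := by field_simp; norm_num
    linarith
  calc (M : ℝ) / 2 * binomialMass N p t
      = ∑ s ∈ Ico (t - M) t, 1 / 2 * binomialMass N p t := by
        rw [sum_const, Nat.card_Ico, Nat.sub_sub_self hMt, nsmul_eq_mul]
        ring
    _ ≤ ∑ s ∈ Ico (t - M) t, binomialMass N p s := by
        refine sum_le_sum fun s hs ↦ ?_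
        obtain ⟨hs1, hs2⟩ := mem_Ico.1 hs
        have hst : s + (t - s) = t := by omega
        have hsM : (t : ℝ) ≤ s + M := by exact_mod_cast (show t ≤ s + M by omega)
        have key := pow_mul_binomialMass_le (N := N) h0 h1 hmp hmq hδ hδ' (k := s) (by linarith)
          (t - s)
        rw [hst] at key
        exact (mul_le_mul_of_nonneg_right (hhalf _ (by omega)) (hb t)).trans key
    _ ≤ ∑ s ∈ range t, binomialMass N p s := by
        refine sum_le_sum_of_subset_of_nonneg ?_ fun i _ _ ↦ hb i
        intro s hs
        exact mem_range.2 (mem_Ico.1 hs).2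

/-- Away from the mean the probabilities decay geometrically. -/
lemma binomialMass_le_mul_succ (h0 : 0 < p) (h1 : p < 1) (hm : 0 ≤ m)
    (hpq : p * (1 - p) ≤ m) {θ : ℝ} (hθ : 0 ≤ θ) (hθ1 : θ ≤ 1)
    (hk : (k + 1 : ℝ) ≤ (N + 1) * p - θ * ((N + 1) * m)) :
    binomialMass N p k ≤ (1 - θ / 2) * binomialMass N p (k + 1) := by
  have h := binomialMass_succ_mul N k p
  have hb' := binomialMass_nonneg h0.le h1.le N (k + 1)
  have hNk : 0 < (N - k : ℝ) := by
    have : 0 < (N + 1) * (1 - p) := by positivity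
    have : 0 ≤ θ * ((N + 1) * m) := by positivity
    linarith
  refine le_of_mul_le_mul_right ?_ (mul_pos hNk h0)
  rw [← h, mul_comm (1 - θ / 2), mul_assoc]
  refine mul_le_mul_of_nonneg_left ?_ hb'
  have e1 : (k + 1 : ℝ) * (1 - p) ≤ ((N + 1) * p - θ * ((N + 1) * m)) * (1 - p) := by gcongr
  have e2 : (1 - θ / 2) * (((N + 1) * (1 - p) + θ * ((N + 1) * m)) * p) ≤
      (1 - θ / 2) * ((N - k) * p) := by
    have : (N + 1) * (1 - p) + θ * ((N + 1) * m) ≤ (N - k : ℝ) := by linarith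
    have : 0 ≤ 1 - θ / 2 := by linarith
    gcongr
  refine e1.trans (le_trans ?_ e2)
  have e3 : (N + 1) * (p * (1 - p)) ≤ (N + 1) * m := by gcongr
  have e4 : θ * ((N + 1) * m) * p ≤ 1 * ((N + 1) * m) * 1 := by gcongr
  nlinarith [mul_le_mul_of_nonneg_left (add_le_add e3 e4) hθ]

lemma binomialMass_le_pow_mul (h0 : 0 < p) (h1 : p < 1) (hm : 0 ≤ m)
    (hpq : p * (1 - p) ≤ m) {θ : ℝ} (hθ : 0 ≤ θ) (hθ1 : θ ≤ 1) (j : ℕ)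
    (hk : (k + j : ℝ) ≤ (N + 1) * p - θ * ((N + 1) * m)) :
    binomialMass N p k ≤ (1 - θ / 2) ^ j * binomialMass N p (k + j) := by
  induction j with
  | zero => simp
  | succ j ih =>
    push_cast at hk
    refine (ih (by linarith)).trans ?_
    rw [pow_succ, mul_assoc, ← add_assoc]
    have h2 : 0 ≤ 1 - θ / 2 := by linarith
    refine mul_le_mul_of_nonneg_left ?_ (by positivity)
    exact binomialMass_le_mul_succ h0 h1 hm hpq hθ hθ1 (by push_cast; linarith)

/-- The lower tail is negligible even after multiplication by `N + 1`: with `a = θ * (N + 1) * m`,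
from each `s < k` the probabilities grow geometrically for at least `⌊a⌋` further steps, which
gives the factor `(1 - θ / 2) ^ ⌊a⌋ ≤ e / (N + 1) ^ 3`. -/
lemma mul_sum_range_binomialMass_le (h0 : 0 < p) (h1 : p < 1) (hm : 0 ≤ m)
    (hpq : p * (1 - p) ≤ m) {θ : ℝ} (hθ : 0 ≤ θ) (hθ1 : θ ≤ 1)
    (hlog : 3 * Real.log (N + 1) ≤ θ / 2 * (θ * ((N + 1) * m)))
    (hk : ∀ s < k, (s : ℝ) ≤ (N + 1) * p - 2 * θ * ((N + 1) * m)) :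
    (N + 1) * ∑ s ∈ range k, binomialMass N p s ≤ Real.exp 1 / (N + 1) := by
  have hN : (0 : ℝ) < N + 1 := by positivity
  set a := θ * ((N + 1) * m) with ha
  have ha0 : 0 ≤ a := by positivity
  have hfl : (⌊a⌋₊ : ℝ) ≤ a := Nat.floor_le ha0
  have h2 : 0 ≤ 1 - θ / 2 := by linarith
  have hterm : ∀ s ∈ range k, binomialMass N p s ≤ (1 - θ / 2) ^ ⌊a⌋₊ := by
    intro s hs
    have hs := hk s (mem_range.1 hs)
    refine (binomialMass_le_pow_mul h0 h1 hm hpq hθ hθ1 ⌊a⌋₊ (by linarith)).trans ?_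
    exact mul_le_of_le_one_right (by positivity) (binomialMass_le_one h0 h1 _)
  have hkN : (k : ℝ) ≤ N + 1 := by
    by_contra! hcon
    have hcon : N + 1 < k := by exact_mod_cast hcon
    have := hk (N + 1) hcon
    push_cast at this
    nlinarith
  have hpow : (1 - θ / 2) ^ ⌊a⌋₊ ≤ Real.exp (1 - 3 * Real.log (N + 1)) := by
    refine (pow_le_pow_left₀ h2 (Real.one_sub_le_exp_neg (θ / 2)) _).trans ?_
    rw [← Real.exp_nat_mul, Real.exp_le_exp]
    have := Nat.lt_floor_add_one a
    nlinarith
  have hexp : Real.exp (1 - 3 * Real.log (N + 1)) = Real.exp 1 / (N + 1) ^ 3 := by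
    rw [Real.exp_sub, mul_comm, Real.exp_mul, Real.exp_log hN]
    norm_cast
  calc (N + 1) * ∑ s ∈ range k, binomialMass N p s
      ≤ (N + 1) * ∑ s ∈ range k, Real.exp 1 / (N + 1) ^ 3 := by
        gcongr with s hs
        exact (hterm s hs).trans (hpow.trans hexp.le)
    _ = (N + 1) * (k * (Real.exp 1 / (N + 1) ^ 3)) := by simp
    _ ≤ (N + 1) * ((N + 1) * (Real.exp 1 / (N + 1) ^ 3)) := by gcongr
    _ = Real.exp 1 / (N + 1) := by field_simp

/-- There is a threshold `t` below the mean such that the expected number of vertices of degree at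
most `t` is at least `K` but not much more: by `htail` the threshold lies close enough to the mean
for a single degree to contribute little. -/
lemma exists_threshold (h0 : 0 < p) (h1 : p < 1) (hmp : m ≤ p)
    (hmq : m ≤ 1 - p) {M : ℕ} {K : ℝ} (hK : 0 < K) (hKM : 2 * K ≤ M)
    (hlarge : (M : ℝ) + 1 ≤ 1 / (8 * M) * ((N + 1) * m))
    (htail : ∀ k : ℕ, (∀ s < k, (s : ℝ) ≤ (N + 1) * p - 1 / (8 * M) * ((N + 1) * m)) →
      (N + 1) * ∑ s ∈ range k, binomialMass N p s < K) :
    ∃ t : ℕ, (t : ℝ) ≤ (N + 1) * p ∧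
      K ≤ (N + 1) * ∑ s ∈ range (t + 1), binomialMass N p s ∧
      (N + 1) * ∑ s ∈ range (t + 1), binomialMass N p s ≤ K + 2 * K / M ∧
      ∀ s ≤ t, (N + 1) * binomialMass N p s ≤ 2 * K / M := by
  have hM0 : (0 : ℝ) < M := by linarith
  have hM : 0 < M := by exact_mod_cast hM0
  have hb := binomialMass_nonneg h0.le h1.le N
  have hA : 1 / (4 * M : ℝ) * ((N + 1) * m) = 2 * (1 / (8 * M) * ((N + 1) * m)) := by
    field_simp
    ring
  set a := 1 / (8 * M : ℝ) * ((N + 1) * m) with ha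
  have hA' : 8 * a ≤ (N + 1) * p := by
    have e : 8 * M * a = (N + 1) * m := by
      rw [ha]
      field_simp
    have hM1 : (1 : ℝ) ≤ M := by exact_mod_cast hM
    have : (N + 1) * m ≤ (N + 1) * p := by gcongr
    nlinarith
  -- Between the tail and the mean, `t - M` is still close to the mean.
  have hwin : ∀ t : ℕ, (N + 1) * p - a - 1 < t →
      M / 2 * ((N + 1) * binomialMass N p t) ≤ (N + 1) * ∑ s ∈ range t, binomialMass N p s := by
    intro t ht
    have hMt : M ≤ t := by
      have : (M : ℝ) ≤ t := by linarith
      exact_mod_cast this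
    have := mul_binomialMass_le_sum (N := N) h0 h1 hmp hmq hM (by rw [hA]; linarith) hMt
    calc M / 2 * ((N + 1) * binomialMass N p t)
        = (N + 1) * (M / 2 * binomialMass N p t) := by ring
      _ ≤ _ := by gcongr
  have hnp : 0 ≤ (N + 1) * p := by positivity
  -- The mode alone contributes at least 1, so the `M` degrees before it contribute `M / 2 ≥ K`.
  have hfloor : K ≤ (N + 1) * ∑ s ∈ range (⌊(N + 1) * p⌋₊ + 1), binomialMass N p s := by
    have e1 := hwin ⌊(N + 1) * p⌋₊ (by linarith [Nat.lt_floor_add_one ((N + 1) * p)])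
    have e2 := one_le_mul_binomialMass_floor (N := N) h0 h1
    have e3 := hb ⌊(N + 1) * p⌋₊
    rw [sum_range_succ, mul_add]
    nlinarith
  have hex : ∃ t : ℕ, K ≤ (N + 1) * ∑ s ∈ range (t + 1), binomialMass N p s := ⟨_, hfloor⟩
  classical
  have htle : (Nat.find hex : ℝ) ≤ (N + 1) * p :=
    (Nat.cast_le.2 (Nat.find_min' hex hfloor)).trans (Nat.floor_le hnp)
  have ht := Nat.find_spec hex
  have hmin := fun s (hs : s < Nat.find hex) ↦ not_le.1 (Nat.find_min hex hs)
  set t := Nat.find hex with ht_def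
  have hlt : (N + 1) * ∑ s ∈ range t, binomialMass N p s < K := by
    rcases Nat.eq_zero_or_pos t with h | h
    · simpa [h] using hK
    · simpa [Nat.sub_add_cancel h] using hmin (t - 1) (by omega)
  have hgt : (N + 1) * p - a < t := by
    by_contra! hcon
    refine (htail (t + 1) fun s hs ↦ ?_).not_ge ht
    have : (s : ℝ) ≤ t := by exact_mod_cast Nat.lt_succ_iff.1 hs
    linarith
  have hbt : (N + 1) * binomialMass N p t ≤ 2 * K / M := by
    rw [le_div_iff₀ hM0]
    linarith [hwin t (by linarith)]
  refine ⟨t, htle, ht, ?_, fun s hs ↦ le_trans ?_ hbt⟩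
  · rw [sum_range_succ, mul_add]
    linarith
  · have := binomialMass_le_of_le h0 h1 htle hs
    gcongr

end BinomialMass

/-! ### Asymptotics -/

lemma measureReal_not_eq {Ω : Type*} [MeasurableSpace Ω] [DiscreteMeasurableSpace Ω]
    (μ : Measure Ω) [IsProbabilityMeasure μ] (Q : Ω → Prop) :
    μ.real {ω | ¬ Q ω} = 1 - μ.real {ω | Q ω} := by
  rw [← probReal_compl_eq_one_sub .of_discrete]
  rfl

/-- The error bound for a fixed graph size. Here `K` is, up to a bounded error, the expected number
of vertices whose degree lies in the interval under consideration, and the interval reaches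
`1 / (8 * M) * ((N + 1) * min p (1 - p))` below the mean. -/
lemma binomialRandom_not_minDegreeNeighbourhoodHas_le_mul {N : ℕ} {p : unitInterval}
    (hp : 0 < (p : ℝ)) (hp1 : (p : ℝ) < 1) (P : ℕ → GraphProperty) {ε : ℝ} (hε : 0 < ε)
    (hε1 : ε ≤ 1) {M : ℕ} {K : ℝ} (hK : K = 1 / ε + 1) (hM : 2 * K * (K + 1) / ε ≤ M)
    (hlarge : (M : ℝ) + 1 ≤ 1 / (8 * M) * ((N + 1) * min (p : ℝ) (1 - p)))
    (htail : ∀ k : ℕ,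
      (∀ s < k, (s : ℝ) ≤ (N + 1) * p - 1 / (8 * M) * ((N + 1) * min (p : ℝ) (1 - p))) →
      (N + 1) * ∑ s ∈ range k, binomialMass N p s ≤ ε)
    (hP : ∀ s : ℕ, (1 / 2 : ℝ) * (N + 1) * p ≤ s → (s : ℝ) ≤ 2 * (N + 1) * p →
      1 - ε / (K + 1) ≤ (SimpleGraph.binomialRandom (Fin s) p).real {G | (P s).Holds G}) :
    (SimpleGraph.binomialRandom (Fin (N + 1)) p).real {G | ¬ MinDegreeNeighbourhoodHas P G} ≤
      6 * ε := by
  set m := min (p : ℝ) (1 - p) with hm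
  have hmp : m ≤ p := min_le_left _ _
  have hmq : m ≤ 1 - p := min_le_right _ _
  have h1ε : 1 ≤ 1 / ε := by rwa [one_le_div hε]
  have hK2 : 2 ≤ K := by linarith
  have hKε : K < K * (K + 1) / ε := by
    rw [lt_div_iff₀ hε]
    nlinarith
  have hKM : 2 * K ≤ M := by
    have : 2 * K * (K + 1) / ε = 2 * (K * (K + 1) / ε) := by ring
    linarith
  have hM0 : (0 : ℝ) < M := by linarith
  have hb := binomialMass_nonneg hp.le hp1.le N
  obtain ⟨t, ht, hKt, htK, hbt⟩ := exists_threshold (N := N) hp hp1 hmp hmq (by linarith) hKM hlarge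
    fun k hk ↦ (htail k hk).trans_lt (by linarith)
  have h2KM : 2 * K / M ≤ 1 := by rwa [div_le_one hM0]
  set d := 1 / (8 * M : ℝ) * ((N + 1) * m) with hd
  have hd8 : d ≤ (N + 1) * m / 16 := by
    have : 1 / (8 * M : ℝ) ≤ 1 / 16 := one_div_le_one_div_of_le (by norm_num) (by linarith)
    calc d ≤ 1 / 16 * ((N + 1) * m) := by rw [hd]; gcongr
      _ = _ := by ring
  have hnm : (N + 1) * m ≤ (N + 1) * p := by gcongr
  -- Degrees below `a` belong to the tail; those in `Icc a t` are within `d` of the mean.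
  set a := ⌈(N + 1) * (p : ℝ) - d⌉₊ with ha
  have ha1 : 1 ≤ a := Nat.one_le_ceil_iff.2 (by linarith)
  have hIcc : ∀ s ∈ Icc a t, (N + 1) * (p : ℝ) - d ≤ s ∧ (s : ℝ) ≤ (N + 1) * p := by
    intro s hs
    obtain ⟨h1, h2⟩ := mem_Icc.1 hs
    exact ⟨Nat.ceil_le.1 h1, le_trans (by exact_mod_cast h2) ht⟩
  have htaila : (N + 1) * ∑ s ∈ range a, binomialMass N p s ≤ ε :=
    htail a fun s hs ↦ (Nat.lt_ceil.1 hs).le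
  set I := (N + 1) * ∑ s ∈ Icc a t, binomialMass N p s with hI
  have hI1 : 1 / ε ≤ I := by
    have : ∑ s ∈ range (t + 1), binomialMass N p s ≤
        ∑ s ∈ range a, binomialMass N p s + ∑ s ∈ Icc a t, binomialMass N p s := by
      rw [← sum_union (by
        rw [Finset.disjoint_left]
        intro s h1 h2
        exact absurd (mem_range.1 h1) (mem_Icc.1 h2).1.not_gt)]
      refine sum_le_sum_of_subset_of_nonneg (fun s hs ↦ ?_) fun s _ _ ↦ hb s
      simp only [mem_union, mem_range, mem_Icc] at hs ⊢
      omega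
    have : (N + 1) * ∑ s ∈ range (t + 1), binomialMass N p s ≤
        (N + 1) * (∑ s ∈ range a, binomialMass N p s + ∑ s ∈ Icc a t, binomialMass N p s) := by
      gcongr
    rw [mul_add] at this
    linarith
  have hI2 : I ≤ K + 1 := by
    have : ∑ s ∈ Icc a t, binomialMass N p s ≤ ∑ s ∈ range (t + 1), binomialMass N p s := by
      refine sum_le_sum_of_subset_of_nonneg (fun s hs ↦ ?_) fun s _ _ ↦ hb s
      simp only [mem_range, mem_Icc] at hs ⊢
      omega
    have : I ≤ (N + 1) * ∑ s ∈ range (t + 1), binomialMass N p s := by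
      rw [hI]
      gcongr
    linarith
  have hI0 : 0 < I := by linarith
  have hN1 : ((N : ℝ) + 1) / 2 ≤ N := by
    have h1 : (N + 1) * m ≤ (N + 1) * 1 := by gcongr; linarith
    linarith
  have hκ : ∀ s ∈ Icc a t, ∀ s' ∈ Icc a t,
      (s - N * p : ℝ) * (s' - N * p) / (N ^ 2 * p * (1 - p)) ≤ ε := by
    intro s hs s' hs'
    have hdev : ∀ s ∈ Icc a t, |(s - N * p : ℝ)| ≤ d := by
      intro s hs
      obtain ⟨h1, h2⟩ := hIcc s hs
      rw [abs_le]
      constructor <;> linarith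
    have hden : ((N + 1) * m) ^ 2 / 4 ≤ N ^ 2 * p * (1 - p) := by
      calc ((N + 1) * m) ^ 2 / 4 = ((N + 1) / 2) ^ 2 * m * m := by ring
        _ ≤ (N : ℝ) ^ 2 * p * (1 - p) := by gcongr
    have hden0 : 0 < ((N + 1) * m) ^ 2 / 4 := by positivity
    rw [div_le_iff₀ (hden0.trans_le hden)]
    have hMε : 1 / (M : ℝ) ≤ ε := by
      rw [div_le_iff₀ hM0, mul_comm]
      rw [div_le_iff₀ hε] at hM
      nlinarith
    calc (s - N * p : ℝ) * (s' - N * p) ≤ |(s - N * p : ℝ)| * |(s' - N * p : ℝ)| := by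
          rw [← abs_mul]
          exact le_abs_self _
      _ ≤ d * d := by
          have := hdev s hs
          have := hdev s' hs'
          gcongr
      _ = 1 / (M * 16 : ℝ) * (1 / M) * (((N + 1) * m) ^ 2 / 4) := by
          rw [hd]
          field_simp
          ring
      _ ≤ 1 * ε * (N ^ 2 * p * (1 - p)) := by
          have : 1 / (M * 16 : ℝ) ≤ 1 := by
            rw [div_le_one (by positivity)]
            linarith
          gcongr
      _ = ε * (N ^ 2 * p * (1 - p)) := by ring
  have hη : ∀ s ∈ Icc a t,
      (SimpleGraph.binomialRandom (Fin s) p).real {G | ¬ (P s).Holds G} ≤ ε / (K + 1) := by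
    intro s hs
    obtain ⟨h1, h2⟩ := hIcc s hs
    rw [measureReal_not_eq]
    linarith [hP s (by linarith) (by linarith)]
  have key := binomialRandom_not_minDegreeNeighbourhoodHas_le (V := Fin (N + 1)) (N := N) hp hp1
    (by simp) P ha1 hε.le hκ (m := I) (c := 2 * K / M) (by simp [hI]) hI0
    (fun s hs ↦ by simpa using hbt s (mem_Icc.1 hs).2) hη
  simp only [Fintype.card_fin, Nat.cast_add, Nat.cast_one] at key
  refine key.trans ?_
  have e1 : 1 / I ≤ ε := by
    rw [div_le_iff₀ hI0]
    rwa [div_le_iff₀ hε, mul_comm] at hI1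
  have e2 : (1 + ε) * (I * (2 * K / M)) ≤ 2 * ε := by
    have : I * (2 * K / M) ≤ ε := by
      calc I * (2 * K / M) ≤ (K + 1) * (2 * K / M) := by gcongr
        _ = 2 * K * (K + 1) / M := by ring
        _ ≤ ε := by rwa [div_le_comm₀ hM0 hε]
    exact mul_le_mul (by linarith) this (by positivity) (by norm_num)
  have e3 : I * (ε / (K + 1)) ≤ ε := by
    calc I * (ε / (K + 1)) ≤ (K + 1) * (ε / (K + 1)) := by gcongr
      _ = ε := by field_simp
  linarith

/-- `p ≫ log n / n` in the form in which it is used: `n * p` eventually exceeds each multiple of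
`log n`. -/
lemma eventually_mul_log_le {f : ℕ → ℝ} (hf : ∀ n, 0 ≤ f n)
    (h : (fun n : ℕ ↦ Real.log n / n) =o[atTop] f) {C : ℝ} (hC : 0 < C) :
    ∀ᶠ n : ℕ in atTop, C * Real.log n ≤ n * f n := by
  filter_upwards [h.def (c := C⁻¹) (by positivity), eventually_gt_atTop 0] with n hn hpos
  have hpos : (0 : ℝ) < n := by exact_mod_cast hpos
  rw [Real.norm_of_nonneg (hf n)] at hn
  have := (le_abs_self _).trans hn
  rw [div_le_iff₀ hpos, mul_assoc, ← div_eq_inv_mul, le_div_iff₀ hC] at this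
  linarith

theorem lemma3p7 (p : ℕ → unitInterval)
    (hp : ∀ n, 0 < (p n : ℝ) ∧ (p n : ℝ) < 1)
    -- `p ≫ log n / n`
    (hp_lower : (fun n : ℕ => Real.log n / n) =o[atTop] (fun n : ℕ => (p n : ℝ)))
    -- `1 - p ≫ log n / n`
    (hp_upper : (fun n : ℕ => Real.log n / n) =o[atTop] (fun n : ℕ => 1 - (p n : ℝ)))
    -- `P n s` is the property required of graphs on `s` vertices when `H ∼ G(n, p n)`
    (P : ℕ → ℕ → GraphProperty)
    -- `Pr (G(s, p n) ∈ P n s) = 1 - o(1)` as `n → ∞`, uniformly in `s ∈ [0.5 n p, 2 n p]`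
    (hP : ∀ ε : ℝ, 0 < ε → ∀ᶠ n : ℕ in atTop, ∀ s : ℕ,
      (1 / 2 : ℝ) * n * p n ≤ s → (s : ℝ) ≤ 2 * n * p n →
        1 - ε ≤ (SimpleGraph.binomialRandom (Fin s) (p n)).real
          {G : SimpleGraph (Fin s) | (P n s).Holds G}) :
    Tendsto
      (fun n : ℕ => (SimpleGraph.binomialRandom (Fin n) (p n)).real
        {H : SimpleGraph (Fin n) | MinDegreeNeighbourhoodHas (P n) H})
      atTop (𝓝 1) := by
  rw [Metric.tendsto_nhds]
  intro ε₀ hε₀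
  set ε := min 1 ε₀ / 7 with hε_def
  have hmin0 : 0 < min 1 ε₀ := lt_min one_pos hε₀
  have hε : 0 < ε := by positivity
  have hε1 : ε ≤ 1 := by linarith [min_le_left 1 ε₀]
  have hε2 : 6 * ε < ε₀ := by linarith [min_le_right 1 ε₀]
  obtain ⟨K, hK⟩ : ∃ K, K = 1 / ε + 1 := ⟨_, rfl⟩
  have hK0 : 0 < K := by rw [hK]; positivity
  obtain ⟨M, hM⟩ := exists_nat_ge (2 * K * (K + 1) / ε)
  have hM0 : (0 : ℝ) < M := lt_of_lt_of_le (by positivity) hM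
  have hM1 : (1 : ℝ) ≤ M := Nat.one_le_cast.2 (Nat.cast_pos.1 hM0)
  set θ : ℝ := 1 / (16 * M) with hθ
  have hθ0 : 0 < θ := by positivity
  have hθ1 : θ ≤ 1 := by
    rw [hθ, div_le_one (by positivity)]
    linarith
  have h2θ : 1 / (8 * M) = 2 * θ := by
    rw [hθ]
    field_simp
    norm_num
  have hC : 0 < 6 / θ ^ 2 := by positivity
  have hlogtop : Tendsto (fun n : ℕ ↦ Real.log n) atTop atTop :=
    Real.tendsto_log_atTop.comp tendsto_natCast_atTop_atTop
  have hexp : Tendsto (fun n : ℕ ↦ Real.exp 1 / (n : ℝ)) atTop (𝓝 0) :=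
    tendsto_const_div_atTop_nhds_zero_nat _
  filter_upwards [eventually_mul_log_le (fun n ↦ (hp n).1.le) hp_lower hC,
    eventually_mul_log_le (fun n ↦ by linarith [(hp n).2]) hp_upper hC,
    hlogtop.eventually_ge_atTop (((M : ℝ) + 1) * θ), hexp.eventually_le_const hε,
    hP (ε / (K + 1)) (by positivity), eventually_ge_atTop 1] with n hlow hupp hlog hexp hPn hn
  obtain ⟨N, rfl⟩ : ∃ N, n = N + 1 := ⟨n - 1, by omega⟩
  set q := p (N + 1)
  have hp0 : 0 < (q : ℝ) := (hp _).1
  have hp1 : (q : ℝ) < 1 := (hp _).2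
  push_cast at hlow hupp hlog hexp hPn
  have hm0 : 0 ≤ min (q : ℝ) (1 - q) := le_min hp0.le (by linarith)
  have hpq : (q : ℝ) * (1 - q) ≤ min (q : ℝ) (1 - q) := by
    refine le_min ?_ ?_ <;> nlinarith
  have hmin : 6 / θ ^ 2 * Real.log (N + 1) ≤ (N + 1) * min (q : ℝ) (1 - q) := by
    rcases min_choice (q : ℝ) (1 - q) with h | h <;> rw [h] <;> assumption
  have hmin' : 3 * Real.log (N + 1) ≤ θ / 2 * (θ * ((N + 1) * min (q : ℝ) (1 - q))) := by
    calc 3 * Real.log (N + 1) = θ / 2 * (θ * (6 / θ ^ 2 * Real.log (N + 1))) := by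
          field_simp
          ring
      _ ≤ _ := by gcongr
  have hlarge : (M : ℝ) + 1 ≤ 1 / (8 * M) * ((N + 1) * min (q : ℝ) (1 - q)) := by
    rw [h2θ]
    have : θ / 2 * (3 * ((M : ℝ) + 1)) ≤ θ / 2 * (θ * ((N + 1) * min (q : ℝ) (1 - q))) := by
      nlinarith
    have := le_of_mul_le_mul_left this (by positivity)
    nlinarith
  have key := binomialRandom_not_minDegreeNeighbourhoodHas_le_mul hp0 hp1 (P (N + 1)) hε hε1 hK hM
    hlarge (fun k hk ↦ (mul_sum_range_binomialMass_le hp0 hp1 hm0 hpq hθ0.le hθ1 hmin'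
      (by rwa [h2θ] at hk)).trans hexp) hPn
  rw [measureReal_not_eq] at key
  rw [Real.dist_eq, abs_sub_comm, abs_of_nonneg (sub_nonneg.2 measureReal_le_one)]
  linarith
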